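/- Let $m\ge 1$ be an integer and put $\mu_j=\binom{m+j}{m-j}$ for $0\le j\le m$ and $\mu_j=0$ for $j>m$. Consider words over the alphabet $\{a,b\}$, and let the valuation $h$ of a word be the sum of the valuations of its letters, where $h(a)=2m+1$ and $h(b)=-2$. A generalized Dyck word is a word $w$ with $h(w)=0$ all of whose left factors (prefixes) $w_1$ satisfy $h(w_1)\ge 0$; a word is factor-free if none of its proper factors is a nonempty generalized Dyck word. Let $U=U_{(2m+1)/2}$ be the language consisting of the empty word together with all words $w$ with $h(w)=0$ that have at least one left factor of negative valuation, all of whose left factors $w_1$ satisfy $h(w_1)>-2m$, and for which $a\,w\,b^m$ is factor-free. (Equivalently, $L_1=a\,U\,b^m$, where $L_1$ is the set of factor-free words of valuation $1$ all of whose nonempty proper left factors have valuation greater than $1$.) Let $u_n$ be the number of words of length $(2m+3)n$ in $U$. Then for every $n\ge 1$ $$u_n=\sum_{k=1}^n\binom{2n}{k-1}\frac{(k-1)!}{n!}\,B_{n,k}(1!\mu_1,2!\mu_2,\dots),$$ where $$B_{n,k}(x_1,x_2,\dots)=\sum\frac{n!}{\prod_{i\ge1} c_i!\,(i!)^{c_i}}\prod_{i\ge1}x_i^{c_i}$$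 is the partial Bell polynomial, the sum being over all integers $c_1,c_2,\dots\ge 0$ with $\sum_i c_i=k$ and $\sum_i i\,c_i=n$. Moreover, the generating function $\mathcal U(t)=\sum_{n\ge0}u_nt^n$ is the unique formal power series over $\mathbb{Q}$ that satisfies $$\mathcal U(t)=1+\sum_{j=1}^m\mu_j\,t^j\,\mathcal U(t)^{2j}.$$ -/

import Mathlib

namespace FactorFree

/-- The two-letter alphabet `{a, b}`. -/
inductive Letter where
  | a : Letter
  | b : Letter
  deriving DecidableEq

instance : Fintype Letter where
  elems := {Letter.a, Letter.b}
  complete := by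
    intro x
    cases x <;> simp

/-- The valuation of a letter: `h(a) = 2m + 1` and `h(b) = -2`. -/
def letterVal (m : ℕ) : Letter → ℤ
  | Letter.a => 2 * (m : ℤ) + 1
  | Letter.b => -2

/-- The total valuation of a word: the sum of the valuations of its letters. -/
def val (m : ℕ) (w : List Letter) : ℤ :=
  (w.map (letterVal m)).sum

/-- The generalized Dyck words: total valuation `0`, and every left factor (prefix) has
nonnegative valuation. -/
def dyckWords (m : ℕ) : Language Letter :=
  {w | val m w = 0 ∧ ∀ w₁ : List Letter, w₁ <+: w → 0 ≤ val m w₁}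

/-- A word is factor-free if it has no proper factor that is a nonempty generalized Dyck word.
(The empty word is a Dyck word and a factor of every word, so it has to be left aside.) -/
def IsFactorFree (m : ℕ) (w : List Letter) : Prop :=
  ∀ w₁ w' w₂ : List Letter, w = w₁ ++ w' ++ w₂ → ¬(w₁ = [] ∧ w₂ = []) → w' ≠ [] →
    w' ∉ dyckWords m

/-- The language `L_i`: the factor-free words of total valuation `i` all of whose nonempty proper
left factors have valuation greater than `i`. -/
def langL (m i : ℕ) : Language Letter :=
  {w | IsFactorFree m w ∧ val m w = i ∧
    ∀ w₁ : List Letter, w₁ <+: w → w₁ ≠ [] → w₁ ≠ w → (i : ℤ) < val m w₁}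

/-- The word `a w b^m`. -/
def wrap (m : ℕ) (w : List Letter) : List Letter :=
  Letter.a :: (w ++ List.replicate m Letter.b)

/-- The auxiliary language `U` of slope `(2m+1)/2`: the empty word together with all words `w` of
total valuation `0` that have at least one left factor of negative valuation, all of whose left
factors have valuation greater than `-2m`, and for which `a w b^m` is factor-free. Factor-freeness
is required of `a w b^m` and not only of `w`, because `U` is the language with `L_1 = a U b^m`
(see `mem_langL_one_iff`); for `m = 2` the word `babbabb` is factor-free but `a babbabb bb` is
not. -/
def auxLang (m : ℕ) : Language Letter :=
  {w | w = [] ∨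
    (IsFactorFree m (wrap m w) ∧ val m w = 0 ∧
      (∃ w₁ : List Letter, w₁ <+: w ∧ val m w₁ < 0) ∧
      ∀ w₁ : List Letter, w₁ <+: w → -2 * (m : ℤ) < val m w₁)}

theorem val_append (m : ℕ) (v w : List Letter) : val m (v ++ w) = val m v + val m w := by
  simp [val]

theorem val_cons (m : ℕ) (c : Letter) (w : List Letter) :
    val m (c :: w) = letterVal m c + val m w := by
  simp [val]

theorem val_replicate_b (m k : ℕ) : val m (List.replicate k Letter.b) = -2 * (k : ℤ) := by
  simp [val, letterVal, mul_comm]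

theorem val_eq_count (m : ℕ) (w : List Letter) :
    val m w = (2 * (m : ℤ) + 1) * (w.count Letter.a : ℤ) - 2 * (w.count Letter.b : ℤ) := by
  induction w with
  | nil => simp [val]
  | cons c w ih =>
    rw [val_cons, ih]
    cases c <;> simp [letterVal] <;> ring

theorem length_eq_count (w : List Letter) :
    w.length = w.count Letter.a + w.count Letter.b := by
  induction w with
  | nil => simp
  | cons c w ih => cases c <;> simp [ih] <;> omega

theorem isFactorFree_wrap_nil (m : ℕ) : IsFactorFree m (wrap m []) := by
  intro w₁ w' w₂ h _ hne hw'
  have h0 := hw'.1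
  have hc : w'.count Letter.a ≤ 1 := by
    have h1 : (wrap m []).count Letter.a = 1 := by
      simp [wrap, List.count_replicate]
    rw [h, List.count_append, List.count_append] at h1
    omega
  rw [val_eq_count] at h0
  have hl := length_eq_count w'
  have hpos := List.length_pos_of_ne_nil hne
  generalize w'.count Letter.a = x at *
  generalize w'.count Letter.b = y at *
  interval_cases x <;> push_cast at h0 <;> omega

theorem exists_wrap_of_mem (m : ℕ) (w : List Letter) (hw : w ∈ langL m 1) (j : ℕ) (hj : j ≤ m) :
    ∃ v, w = Letter.a :: (v ++ List.replicate j Letter.b) := by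
  obtain ⟨_, hv, hp⟩ := hw
  induction j with
  | zero =>
    cases w with
    | nil => simp [val] at hv
    | cons c t =>
      cases c with
      | a => exact ⟨t, by simp⟩
      | b =>
        exfalso
        by_cases ht : t = []
        · subst ht
          simp [val, letterVal] at hv
        · have := hp [Letter.b] ⟨t, by simp⟩ (by simp) (by simpa using Ne.symm ht)
          simp [val, letterVal] at this
  | succ j ih =>
    obtain ⟨v, rfl⟩ := ih (by omega)
    rw [val_cons, val_append, val_replicate_b] at hv
    simp only [letterVal] at hv
    rcases List.eq_nil_or_concat v with rfl | ⟨v', c, rfl⟩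
    · simp [val] at hv
      omega
    · cases c with
      | b => exact ⟨v', by simp [List.replicate_succ]⟩
      | a =>
        exfalso
        have h := hp (Letter.a :: v') ⟨[Letter.a] ++ List.replicate j Letter.b, by simp⟩
          (by simp) (by intro h; simpa using congrArg List.length h)
        have h1 : val m [Letter.a] = 2 * (m : ℤ) + 1 := by simp [val, letterVal]
        rw [List.concat_eq_append, val_append, h1] at hv
        rw [val_cons] at h
        simp only [letterVal] at h
        push_cast at h hv
        omega

/-- The factorization `L_1 = a U b^m` that determines `U`. -/
theorem mem_langL_one_iff (m : ℕ) (hm : 1 ≤ m) (w : List Letter) :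
    w ∈ langL m 1 ↔ ∃ v ∈ auxLang m, w = wrap m v := by
  constructor
  · intro hw
    obtain ⟨v, rfl⟩ := exists_wrap_of_mem m w hw m le_rfl
    refine ⟨v, ?_, rfl⟩
    obtain ⟨hf, hv, hp⟩ := hw
    have hv0 : val m v = 0 := by
      rw [val_cons, val_append, val_replicate_b] at hv
      simp only [letterVal] at hv
      push_cast at hv
      linarith
    by_cases hn : v = []
    · exact Or.inl hn
    refine Or.inr ⟨hf, hv0, ?_, ?_⟩
    · by_contra hcon
      push Not at hcon
      exact hf [Letter.a] v (List.replicate m Letter.b) (by simp) (by simp) hn ⟨hv0, hcon⟩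
    · rintro p ⟨q, rfl⟩
      have := hp (Letter.a :: p) ⟨q ++ List.replicate m Letter.b, by simp⟩ (by simp)
        (by intro h; have := congrArg List.length h; simp at this; omega)
      rw [val_cons] at this
      simp only [letterVal] at this
      push_cast at this
      linarith
  · rintro ⟨v, hv, rfl⟩
    have key : IsFactorFree m (wrap m v) ∧ val m v = 0 ∧
        ∀ w₁ : List Letter, w₁ <+: v → -2 * (m : ℤ) < val m w₁ := by
      rcases hv with rfl | ⟨h1, h2, _, h4⟩
      · refine ⟨isFactorFree_wrap_nil m, by simp [val], ?_⟩
        intro p hp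
        rw [List.prefix_nil.mp hp]
        simp [val]
        omega
      · exact ⟨h1, h2, h4⟩
    obtain ⟨h1, h2, h3⟩ := key
    refine ⟨h1, ?_, ?_⟩
    · rw [wrap, val_cons, val_append, val_replicate_b, h2]
      simp only [letterVal]
      push_cast
      ring
    · intro p hp hne hnw
      cases p with
      | nil => exact absurd rfl hne
      | cons c p =>
        rw [wrap, List.cons_prefix_cons] at hp
        obtain ⟨rfl, hp⟩ := hp
        rw [val_cons]
        simp only [letterVal]
        rcases List.prefix_or_prefix_of_prefix hp (List.prefix_append v _) with hp | ⟨r, rfl⟩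
        · have := h3 p hp
          push_cast
          linarith
        · obtain ⟨hlen, hr'⟩ :=
            List.prefix_replicate_iff.mp ((List.prefix_append_right_inj v).mp hp)
          rw [hr', val_append, val_replicate_b, h2]
          have : r.length ≠ m := by
            intro h
            apply hnw
            rw [wrap, ← h, ← hr']
          push_cast
          omega

/-- The set of words of length `(2m+3)n` in the auxiliary language. -/
def auxWords (m n : ℕ) : Set (List Letter) :=
  {w | w ∈ auxLang m ∧ w.length = (2 * m + 3) * n}

theorem auxWords_finite (m n : ℕ) : (auxWords m n).Finite :=
  (List.finite_length_eq Letter ((2 * m + 3) * n)).subset fun _ hw => hw.2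

/-- `u_n`, the number of words of length `(2m+3)n` in the auxiliary language. -/
noncomputable def auxCount (m n : ℕ) : ℕ :=
  (auxWords m n).ncard

/-- `μ_j = C(m+j, m-j)`, which is `0` for `j > m` (negative lower index). -/
def mu (m j : ℕ) : ℕ :=
  if j ≤ m then (m + j).choose (m - j) else 0

/-- The partial Bell polynomial
`B_{n,k}(x₁, x₂, …) = ∑ n! / (c₁! c₂! ⋯ (1!)^{c₁} (2!)^{c₂} ⋯) x₁^{c₁} x₂^{c₂} ⋯`,
the sum being over all `c₁, c₂, … ≥ 0` with `∑ cᵢ = k` and `∑ i cᵢ = n`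
(so that `cᵢ = 0` for `i > n`). The variable `x₀` does not occur. -/
noncomputable def partialBell (n k : ℕ) : MvPolynomial ℕ ℚ :=
  ∑ c ∈ ((Finset.Icc 1 n).piAntidiag k).filter
      (fun c : ℕ → ℕ => ∑ i ∈ Finset.Icc 1 n, i * c i = n),
    MvPolynomial.C ((n.factorial : ℚ) /
        ∏ i ∈ Finset.Icc 1 n, ((c i).factorial : ℚ) * (i.factorial : ℚ) ^ c i) *
      ∏ i ∈ Finset.Icc 1 n, MvPolynomial.X i ^ c i

end FactorFree

namespace FactorFree

open PowerSeries

/-! ### Descents and the grammar of `L_1` -/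

/-! Let `D_k` be the set `descents m k`. Cut a word of `D_k`, `k ≥ 1`, at its first negative prefix
`u b`. Since `b` lowers the valuation by 2, `u` ends at 0 or 1. As there are no Dyck factors, `u` is
empty in the first case and lies in `L_1` in the second. So `D_k` is the disjoint union of `b
D_{k-2}` and `L_1 b D_{k-1}`, with `D_0 = {ε}` and `D_{-1} = ∅`. Conversely, gluing along such a `b`
creates no Dyck factor (`NoDyck.append_cons_b`).

For length generating functions this is a Fibonacci-type recurrence, and its solution at `k = 2m`
has the coefficients `C(m+j, m-j) = μ_j`. Since `L_1 = a D_{2m} = a U b^m`, the series of `U`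
satisfies the functional equation in `t = X^(2m+3)`.

The equation determines its solution, because the difference of two solutions is divisible by `X`
times itself. Lagrange inversion, proved by induction from the equation itself, gives `(2n+1) u_n =
[t^n] (1 + g)^(2n+1)` with `g = ∑ μ_j t^j`. The binomial theorem then leaves the coefficients of
`g^k`, which are Bell polynomials by the multinomial theorem. -/

/-- No factor of `w`, including `w` itself, is a nonempty generalized Dyck word. -/
def NoDyck (m : ℕ) (w : List Letter) : Prop :=
  ∀ x y z : List Letter, w = x ++ y ++ z → y ≠ [] → y ∉ dyckWords m

/-- The words without Dyck factors that reach valuation `-k` for the first time at their end. -/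
def descents (m : ℕ) (k : ℤ) : Set (List Letter) :=
  {v | NoDyck m v ∧ val m v = -k ∧ ∀ p, p <+: v → p ≠ v → -k < val m p}

@[simp] theorem val_nil (m : ℕ) : val m [] = 0 := by simp [val]

theorem val_cons_a (m : ℕ) (w : List Letter) :
    val m (Letter.a :: w) = 2 * (m : ℤ) + 1 + val m w := val_cons m _ w

theorem val_cons_b (m : ℕ) (w : List Letter) :
    val m (Letter.b :: w) = -2 + val m w := val_cons m _ w

theorem NoDyck.isFactorFree {m : ℕ} {w : List Letter} (h : NoDyck m w) : IsFactorFree m w :=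
  fun x y z e _ hy => h x y z e hy

/-- Factor-freeness leaves open only that the whole word is Dyck, which a nonzero valuation
excludes. -/
theorem IsFactorFree.noDyck {m : ℕ} {w : List Letter} (h : IsFactorFree m w)
    (hw : val m w ≠ 0) : NoDyck m w := by
  intro x y z e hy hd
  by_cases hxz : x = [] ∧ z = []
  · obtain ⟨rfl, rfl⟩ := hxz
    simp only [List.nil_append, List.append_nil] at e
    exact hw (e ▸ hd.1)
  · exact h x y z e hxz hy hd

theorem NoDyck.of_append {m : ℕ} {u v w : List Letter} (h : NoDyck m (u ++ v ++ w)) :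
    NoDyck m v := by
  rintro x y z rfl
  exact h (u ++ x) y (z ++ w) (by simp)

theorem noDyck_nil (m : ℕ) : NoDyck m [] := by
  intro x y z e hy
  simp_all

/-- The prefixes of a word of `L_1` have nonnegative valuation. -/
theorem val_nonneg_of_prefix_langL {m : ℕ} {u p : List Letter} (hu : u ∈ langL m 1)
    (hp : p <+: u) : 0 ≤ val m p := by
  obtain ⟨_, h1, h2⟩ := hu
  by_cases hp0 : p = []
  · simp [hp0]
  by_cases hpu : p = u
  · rw [hpu, h1]; simp
  · have := h2 p hp hp0 hpu
    push_cast at this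
    omega

theorem noDyck_of_mem_langL {m : ℕ} {u : List Letter} (hu : u ∈ langL m 1) : NoDyck m u :=
  hu.1.noDyck (by rw [hu.2.1]; simp)

theorem nil_notMem_langL (m : ℕ) : [] ∉ langL m 1 := by
  rintro ⟨_, h, _⟩
  simp at h

/-- A factor that starts inside `u b` and runs past this `b` has a prefix that is a nonempty suffix
of `u b`. Such a suffix has negative valuation, so the factor is not Dyck. -/
theorem NoDyck.append_cons_b {m : ℕ} {u v : List Letter} (hu : NoDyck m u) (hv : NoDyck m v)
    (hp : ∀ p, p <+: u → 0 ≤ val m p) (hu2 : val m u < 2) : NoDyck m (u ++ Letter.b :: v) := by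
  -- The valuation of `s` is `val u - 2 - val x`, where `val u < 2` and `x`, a prefix of `u`, has
  -- `val x ≥ 0`.
  have hs : ∀ x s : List Letter, u ++ [Letter.b] = x ++ s → s ≠ [] → val m s < 0 := by
    intro x s e hs0
    have hx : x <+: u := by
      rcases List.prefix_concat_iff.mp (⟨s, e.symm⟩ : x <+: u ++ [Letter.b]) with h | h
      · subst h
        simp at e
        exact absurd e hs0
      · exact h
    have h1 := congrArg (val m) e
    rw [val_append, val_append, val_cons_b, val_nil] at h1
    have := hp x hx
    omega
  intro x y z e hy hd
  have e' : (u ++ [Letter.b]) ++ v = x ++ (y ++ z) := by simpa using e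
  rcases List.append_eq_append_iff.mp e' with ⟨s, rfl, hv'⟩ | ⟨s, hub, hyz⟩
  · exact hv s y z (by simpa using hv') hy hd
  · by_cases hs0 : s = []
    · subst hs0
      exact hv [] y z (by simpa using hyz.symm) hy hd
    have hneg := hs x s hub hs0
    -- Either `y` ends within `u b`, or the negative suffix `s` is a prefix of `y`.
    rcases List.append_eq_append_iff.mp hyz with ⟨r, rfl, hr⟩ | ⟨r, rfl, hr⟩
    · rcases List.eq_nil_or_concat r with rfl | ⟨r', c, rfl⟩
      · rw [List.append_nil, hd.1] at hneg
        omega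
      · have : u = x ++ y ++ r' := by
          have h2 : u ++ [Letter.b] = (x ++ y ++ r') ++ [c] := by simpa using hub
          exact (List.append_inj' h2 rfl).1
        exact hu x y r' this hy hd
    · have := hd.2 s (List.prefix_append _ _)
      omega

/-- The initial letter must be `a`; it lifts the path to `2m + 1`, which is `2m` above the final
valuation 1. -/
theorem mem_langL_one_iff_descents (m : ℕ) (w : List Letter) :
    w ∈ langL m 1 ↔ ∃ v ∈ descents m (2 * m), w = Letter.a :: v := by
  constructor
  · intro hw
    obtain ⟨v, hv⟩ := exists_wrap_of_mem m w hw 0 (Nat.zero_le _)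
    simp only [List.replicate_zero, List.append_nil] at hv
    subst hv
    refine ⟨v, ⟨?_, ?_, ?_⟩, rfl⟩
    · have := noDyck_of_mem_langL hw
      exact NoDyck.of_append (u := [Letter.a]) (w := []) (by simpa using this)
    · have := hw.2.1
      rw [val_cons_a] at this
      push_cast at this
      omega
    · intro p hp hpv
      have := hw.2.2 (Letter.a :: p) (by simpa using hp) (by simp) (by simpa using hpv)
      rw [val_cons_a] at this
      push_cast at this
      omega
  · rintro ⟨v, ⟨h1, h2, h3⟩, rfl⟩
    have hval : val m (Letter.a :: v) = 1 := by
      rw [val_cons_a, h2]; ring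
    have hpos : ∀ p, p <+: v → p ≠ v → 1 < val m (Letter.a :: p) := by
      intro p hp hpv
      have := h3 p hp hpv
      rw [val_cons_a]
      omega
    refine ⟨NoDyck.isFactorFree ?_, by simpa using hval, ?_⟩
    · intro x y z e hy hd
      -- A Dyck factor starting at the initial `a` would be a nonempty prefix of valuation 0, but
      -- all of these have valuation at least 1.
      cases x with
      | nil =>
        cases y with
        | nil => exact hy rfl
        | cons c y =>
          simp only [List.nil_append, List.cons_append, List.cons.injEq] at e
          obtain ⟨rfl, e⟩ := e
          have h0 := hd.1
          by_cases hyv : y = v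
          · rw [hyv, hval] at h0
            omega
          · have := hpos y ⟨z, e.symm⟩ hyv
            omega
      | cons c x =>
        simp only [List.cons_append, List.cons.injEq] at e
        exact h1 x y z e.2 hy hd
    · intro p hp hp0 hpv
      cases p with
      | nil => exact absurd rfl hp0
      | cons c p =>
        rw [List.cons_prefix_cons] at hp
        obtain ⟨rfl, hp⟩ := hp
        exact_mod_cast hpos p hp (by simpa using hpv)

theorem descents_zero (m : ℕ) : descents m 0 = {[]} := by
  ext v
  simp only [Set.mem_singleton_iff]
  constructor
  · rintro ⟨_, _, h⟩
    by_contra hv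
    have := h [] (List.nil_prefix) (Ne.symm hv)
    simp at this
  · rintro rfl
    exact ⟨noDyck_nil m, by simp, fun p hp hne => absurd (List.prefix_nil.mp hp) hne⟩

/-- This boundary value lets the first-passage decomposition hold already at `k = 1`, where an
initial `b` would overshoot the target. -/
theorem descents_neg_one (m : ℕ) : descents m (-1) = ∅ := by
  ext v
  simp only [Set.mem_empty_iff_false, iff_false]
  rintro ⟨_, h1, h⟩
  by_cases hv : v = []
  · subst hv
    simp at h1
  · have := h [] (List.nil_prefix) (Ne.symm hv)
    simp at this

/-- A word with a left factor of negative valuation has a first one. -/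
theorem exists_first_negative (m : ℕ) (w : List Letter) (h : ∃ p, p <+: w ∧ val m p < 0) :
    ∃ u c t, w = u ++ c :: t ∧ (∀ p, p <+: u → 0 ≤ val m p) ∧
      val m u + letterVal m c < 0 := by
  induction w using List.reverseRecOn with
  | nil =>
    obtain ⟨p, hp, hlt⟩ := h
    rw [List.prefix_nil.mp hp] at hlt
    simp at hlt
  | append_singleton w c ih =>
    by_cases h' : ∃ p, p <+: w ∧ val m p < 0
    · obtain ⟨u, d, t, rfl, h1, h2⟩ := ih h'
      exact ⟨u, d, t ++ [c], by simp, h1, h2⟩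
    · push Not at h'
      obtain ⟨p, hp, hlt⟩ := h
      rcases List.prefix_concat_iff.mp hp with rfl | hp
      · refine ⟨w, c, [], rfl, h', ?_⟩
        rw [val_append, val_cons, val_nil] at hlt
        omega
      · exact absurd hlt (not_lt.mpr (h' p hp))

theorem append_cons_b_mem_descents {m : ℕ} {k : ℤ} (hk : 1 ≤ k) {u v : List Letter}
    (hu : NoDyck m u) (hp : ∀ p, p <+: u → 0 ≤ val m p) (hu2 : val m u < 2)
    (hv : v ∈ descents m (k - 2 + val m u)) : u ++ Letter.b :: v ∈ descents m k := by
  obtain ⟨h1, h2, h3⟩ := hv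
  refine ⟨hu.append_cons_b h1 hp hu2, ?_, ?_⟩
  · rw [val_append, val_cons_b, h2]
    ring
  · intro p hpp hne
    rcases List.prefix_or_prefix_of_prefix hpp (List.prefix_append u _) with h | ⟨r, rfl⟩
    · have := hp p h
      omega
    · rw [List.prefix_append_right_inj] at hpp
      cases r with
      | nil =>
        have := hp u List.prefix_rfl
        rw [List.append_nil]
        omega
      | cons c r =>
        rw [List.cons_prefix_cons] at hpp
        obtain ⟨rfl, hr⟩ := hpp
        have := h3 r hr (by rintro rfl; exact hne rfl)
        rw [val_append, val_cons_b]
        omega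

theorem mem_descents_of_append_cons_b {m : ℕ} {k : ℤ} {u v : List Letter}
    (h : u ++ Letter.b :: v ∈ descents m k) : v ∈ descents m (k - 2 + val m u) := by
  obtain ⟨h1, h2, h3⟩ := h
  rw [val_append, val_cons_b] at h2
  refine ⟨NoDyck.of_append (u := u ++ [Letter.b]) (w := []) (by simpa using h1), by omega, ?_⟩
  intro p hp hne
  have := h3 (u ++ Letter.b :: p)
    (by rw [List.prefix_append_right_inj]; simpa using hp) (by simpa using hne)
  rw [val_append, val_cons_b] at this
  omega

/-- A word without Dyck factors that climbs from `0` to `1` and stays nonnegative is in `L_1`. -/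
theorem mem_langL_one_of_noDyck {m : ℕ} {u : List Letter} (hu : NoDyck m u)
    (hp : ∀ p, p <+: u → 0 ≤ val m p) (h1 : val m u = 1) : u ∈ langL m 1 := by
  have hpos : ∀ p, p <+: u → p ≠ [] → 1 ≤ val m p := by
    rintro p ⟨r, rfl⟩ hne
    have h0 := hp p (List.prefix_append _ _)
    rcases h0.lt_or_eq with h0 | h0
    · omega
    · exact absurd ⟨h0.symm, fun q hq => hp q (hq.trans (List.prefix_append _ _))⟩
        (hu [] p r (by simp) hne)
  refine ⟨hu.isFactorFree, by simpa using h1, ?_⟩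
  rintro p ⟨r, rfl⟩ hne hnu
  have h2 := hpos p (List.prefix_append _ _) hne
  rcases h2.lt_or_eq with h2 | h2
  · exact_mod_cast h2
  · exfalso
    -- If `p` already reaches 1, the rest `r` runs from 1 to 1 without going below 1, so it is a
    -- Dyck factor.
    refine hu p r [] (by simp) (by rintro rfl; simp at hnu) ⟨?_, ?_⟩
    · rw [val_append] at h1
      omega
    · intro q hq
      have := hpos (p ++ q) ((List.prefix_append_right_inj p).mpr hq) (by simp [hne])
      rw [val_append] at this
      omega

/-- First-passage decomposition of a descent. -/
theorem mem_descents_iff (m : ℕ) (k : ℤ) (hk : 1 ≤ k) (v : List Letter) :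
    v ∈ descents m k ↔ (∃ v' ∈ descents m (k - 2), v = Letter.b :: v') ∨
      ∃ u ∈ langL m 1, ∃ v' ∈ descents m (k - 1), v = u ++ Letter.b :: v' := by
  constructor
  · intro hv
    obtain ⟨u, c, t, rfl, hp, hlt⟩ := exists_first_negative m v
      ⟨v, List.prefix_rfl, by rw [hv.2.1]; omega⟩
    have hu0 := hp u List.prefix_rfl
    cases c with
    | a =>
      simp only [letterVal] at hlt
      omega
    | b =>
      simp only [letterVal] at hlt
      have ht := mem_descents_of_append_cons_b hv
      have hu : NoDyck m u := NoDyck.of_append (u := []) (w := Letter.b :: t) hv.1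
      rcases hu0.lt_or_eq with h | h
      · have h1 : val m u = 1 := by omega
        rw [h1, show k - 2 + 1 = k - 1 by ring] at ht
        exact Or.inr ⟨u, mem_langL_one_of_noDyck hu hp h1, t, ht, rfl⟩
      · have hnil : u = [] := by
          by_contra hne
          exact hu [] u [] (by simp) hne ⟨h.symm, hp⟩
        subst hnil
        exact Or.inl ⟨t, by simpa using ht, rfl⟩
  · rintro (⟨v', hv', rfl⟩ | ⟨u, hu, v', hv', rfl⟩)
    · refine append_cons_b_mem_descents (u := []) hk (noDyck_nil m) ?_ (by simp)
        (by simpa using hv')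
      intro p hp
      rw [List.prefix_nil.mp hp, val_nil]
    · have h1 : val m u = 1 := by simpa using hu.2.1
      refine append_cons_b_mem_descents hk (noDyck_of_mem_langL hu)
        (fun p hp => val_nonneg_of_prefix_langL hu hp) (by omega) ?_
      rwa [h1, show k - 2 + 1 = k - 1 by ring]

/-- The first-passage decomposition is unique. -/
theorem first_passage_unique {m : ℕ} {u u' v v' : List Letter}
    (hp : ∀ p, p <+: u → 0 ≤ val m p) (hu : val m u < 2)
    (hp' : ∀ p, p <+: u' → 0 ≤ val m p) (hu' : val m u' < 2)
    (e : u ++ Letter.b :: v = u' ++ Letter.b :: v') : u = u' ∧ v = v' := by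
  -- If `u` were a proper prefix of `u'`, then `u b` would be a prefix of `u'` with negative
  -- valuation.
  have key : ∀ {u u' s v v' : List Letter}, val m u < 2 →
      (∀ p, p <+: u' → 0 ≤ val m p) → u' = u ++ s → Letter.b :: v = s ++ Letter.b :: v' →
      s = [] := by
    intro u u' s v v' hu hp' h1 h2
    cases s with
    | nil => rfl
    | cons c s =>
      rw [List.cons_append, List.cons.injEq] at h2
      obtain ⟨rfl, -⟩ := h2
      have := hp' (u ++ [Letter.b]) ⟨s, by simp [h1]⟩
      rw [val_append, val_cons_b, val_nil] at this
      omega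
  rcases List.append_eq_append_iff.mp e with ⟨s, h1, h2⟩ | ⟨s, h1, h2⟩
  · obtain rfl := key hu hp' h1 h2
    simp_all
  · obtain rfl := key hu' hp h1 h2
    simp_all

/-! ### Lagrange inversion and Bell polynomials -/

theorem coeff_X_mul_derivative (F : ℚ⟦X⟧) (n : ℕ) :
    coeff n (X * d⁄dX ℚ F) = n * coeff n F := by
  cases n with
  | zero => simp
  | succ n =>
    rw [coeff_succ_X_mul, coeff_derivative]
    push_cast
    ring

/-- Lagrange inversion for the powers of the solution of `V = 1 + ∑ x_j t^j V^(2j)`. -/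
theorem coeff_pow_of_functional_eq (s : Finset ℕ) (hs : ∀ j ∈ s, 1 ≤ j) (x : ℕ → ℚ) (V : ℚ⟦X⟧)
    (hV : V = 1 + ∑ j ∈ s, C (x j) * X ^ j * V ^ (2 * j)) (n r : ℕ) :
    (2 * n + r : ℚ) * coeff n (V ^ r) =
      r * coeff n ((1 + ∑ j ∈ s, C (x j) * X ^ j) ^ (2 * n + r)) := by
  set f : ℚ⟦X⟧ := 1 + ∑ j ∈ s, C (x j) * X ^ j with hf
  induction n using Nat.strong_induction_on generalizing r with
  | _ n ih =>
  rcases Nat.eq_zero_or_pos n with rfl | hn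
  · have hX : ∀ j ∈ s, (0 : ℚ) ^ j = 0 := fun j hj => zero_pow (by have := hs j hj; omega)
    have hV0 : constantCoeff V = 1 := by
      rw [hV]
      simp only [map_add, map_one, map_sum, map_mul, map_pow, constantCoeff_X]
      rw [Finset.sum_eq_zero fun j hj => by rw [hX j hj]; ring, add_zero]
    have hf0 : constantCoeff f = 1 := by
      rw [hf]
      simp only [map_add, map_one, map_sum, map_mul, map_pow, constantCoeff_X]
      rw [Finset.sum_eq_zero fun j hj => by rw [hX j hj]; ring, add_zero]
    simp [hV0, hf0]
  -- At `r = 0` both sides vanish because `n > 0`; the positivity of `n` also makes `N = 2n + r`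
  -- cancellable later.
  induction r with
  | zero => simp [coeff_one, hn.ne']
  | succ r ihr =>
    set N : ℕ := 2 * n + r with hN
    have hNQ : (N : ℚ) = 2 * n + r := by rw [hN]; push_cast; ring
    have hNpos : (0 : ℚ) < N := by exact_mod_cast (by omega : 0 < N)
    have h1 : coeff n (V ^ (r + 1)) =
        coeff n (V ^ r) + ∑ j ∈ s, x j * coeff n (X ^ j * V ^ (r + 2 * j)) := by
      have : V ^ (r + 1) = V ^ r + ∑ j ∈ s, C (x j) * (X ^ j * V ^ (r + 2 * j)) := by
        rw [pow_succ]
        nth_rewrite 2 [hV]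
        rw [mul_add, mul_one, Finset.mul_sum]
        congr 1
        refine Finset.sum_congr rfl fun j _ => ?_
        rw [pow_add]
        ring
      rw [this, map_add, map_sum]
      simp only [coeff_C_mul]
    -- The exponent `2(n-j) + (r+2j)` equals `N` for every `j`, so the outer induction hypothesis
    -- always produces the same power of `f`.
    have h2 : ∀ j ∈ s, (N : ℚ) * coeff n (X ^ j * V ^ (r + 2 * j)) =
        (r + 2 * j) * coeff n (X ^ j * f ^ N) := by
      intro j hj
      have hj1 := hs j hj
      rw [coeff_X_pow_mul', coeff_X_pow_mul']
      split_ifs with hjn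
      · have := ih (n - j) (by omega) (r + 2 * j)
        rw [show 2 * (n - j) + (r + 2 * j) = N by omega, Nat.cast_sub hjn] at this
        push_cast at this
        rw [← this, hNQ]
        ring
      · simp
    have hXd : X * d⁄dX ℚ f = ∑ j ∈ s, C (j * x j) * X ^ j := by
      rw [hf, map_add, derivative_one, zero_add, map_sum, Finset.mul_sum]
      refine Finset.sum_congr rfl fun j hj => ?_
      ext i
      rw [coeff_X_mul_derivative, coeff_C_mul, coeff_C_mul, coeff_X_pow]
      split_ifs with h
      · rw [h]; ring
      · simp
    have h3 : (N + 1 : ℚ) * coeff n (X * d⁄dX ℚ f * f ^ N) = n * coeff n (f ^ (N + 1)) := by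
      rw [← coeff_X_mul_derivative, derivative_pow, ← coeff_C_mul]
      congr 1
      have : (C ((N : ℚ) + 1) : ℚ⟦X⟧) = ((N + 1 : ℕ) : ℚ⟦X⟧) := by simp
      rw [this, Nat.add_sub_cancel]
      ring
    have h4 : (N : ℚ) * coeff n (V ^ (r + 1)) =
        r * coeff n (f ^ (N + 1)) + 2 * coeff n (X * d⁄dX ℚ f * f ^ N) := by
      have h5 : f ^ (N + 1) = f ^ N + ∑ j ∈ s, C (x j) * (X ^ j * f ^ N) := by
        rw [pow_succ]
        nth_rewrite 2 [hf]
        rw [mul_add, mul_one, Finset.mul_sum]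
        congr 1
        refine Finset.sum_congr rfl fun j _ => ?_
        ring
      have h6 : X * d⁄dX ℚ f * f ^ N = ∑ j ∈ s, C (j * x j) * (X ^ j * f ^ N) := by
        rw [hXd, Finset.sum_mul]
        exact Finset.sum_congr rfl fun j _ => by ring
      rw [h1, h5, h6, mul_add, hNQ, ihr, map_add, map_sum, map_sum, mul_add, add_assoc,
        Finset.mul_sum, Finset.mul_sum, Finset.mul_sum, ← Finset.sum_add_distrib]
      congr 1
      refine Finset.sum_congr rfl fun j hj => ?_
      rw [coeff_C_mul, coeff_C_mul]
      have := h2 j hj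
      rw [hNQ] at this
      linear_combination x j * this
    -- The coefficients combine through `r(N+1) + 2n = N(r+1)`.
    have h5 : (N : ℚ) * ((N + 1) * coeff n (V ^ (r + 1))) =
        N * ((r + 1) * coeff n (f ^ (N + 1))) := by
      linear_combination (N + 1 : ℚ) * h4 + 2 * h3 - coeff n (f ^ (N + 1)) * hNQ
    have h6 := mul_left_cancel₀ hNpos.ne' h5
    rw [show 2 * n + (r + 1) = N + 1 by omega]
    push_cast
    rw [← h6, hNQ]
    ring

/-- The multinomial theorem: the factorials `j!` in the arguments cancel the powers of `i!` in the
Bell denominators. -/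
theorem eval_partialBell (x : ℕ → ℚ) (n k : ℕ) :
    MvPolynomial.eval (fun j : ℕ => (j.factorial : ℚ) * x j) (partialBell n k) =
      (n.factorial : ℚ) / k.factorial *
        coeff n ((∑ j ∈ Finset.Icc 1 n, C (x j) * X ^ j) ^ k) := by
  have hcoeff : ∀ c : ℕ → ℕ,
      coeff n ((Nat.multinomial (Finset.Icc 1 n) c : ℚ⟦X⟧) *
        ∏ i ∈ Finset.Icc 1 n, (C (x i) * X ^ i) ^ c i) =
      if ∑ i ∈ Finset.Icc 1 n, i * c i = n then
        (Nat.multinomial (Finset.Icc 1 n) c : ℚ) * ∏ i ∈ Finset.Icc 1 n, x i ^ c i else 0 := by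
    intro c
    have : ((Nat.multinomial (Finset.Icc 1 n) c : ℚ⟦X⟧) *
        ∏ i ∈ Finset.Icc 1 n, (C (x i) * X ^ i) ^ c i) =
        C ((Nat.multinomial (Finset.Icc 1 n) c : ℚ) * ∏ i ∈ Finset.Icc 1 n, x i ^ c i) *
          X ^ (∑ i ∈ Finset.Icc 1 n, i * c i) := by
      rw [map_mul, map_natCast, map_prod, ← Finset.prod_pow_eq_pow_sum, mul_assoc,
        ← Finset.prod_mul_distrib]
      congr 1
      refine Finset.prod_congr rfl fun i _ => ?_
      rw [mul_pow, map_pow, pow_mul]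
    rw [this, coeff_C_mul, coeff_X_pow]
    by_cases h : ∑ i ∈ Finset.Icc 1 n, i * c i = n
    · rw [if_pos h, if_pos h.symm, mul_one]
    · rw [if_neg h, if_neg (Ne.symm h), mul_zero]
  rw [Finset.sum_pow_eq_sum_piAntidiag, map_sum, Finset.sum_congr rfl fun c _ => hcoeff c,
    ← Finset.sum_filter, Finset.mul_sum, partialBell, map_sum]
  refine Finset.sum_congr rfl fun c hc => ?_
  have hck : ∑ i ∈ Finset.Icc 1 n, c i = k :=
    (Finset.mem_piAntidiag.mp (Finset.mem_filter.mp hc).1).1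
  have hmult : (∏ i ∈ Finset.Icc 1 n, ((c i).factorial : ℚ)) *
      (Nat.multinomial (Finset.Icc 1 n) c : ℚ) = k.factorial := by
    rw [← hck]
    exact_mod_cast Nat.multinomial_spec (Finset.Icc 1 n) c
  have hk : (k.factorial : ℚ) ≠ 0 := by exact_mod_cast k.factorial_ne_zero
  have hc0 : (∏ i ∈ Finset.Icc 1 n, ((c i).factorial : ℚ)) ≠ 0 :=
    Finset.prod_ne_zero_iff.mpr fun i _ => by exact_mod_cast (c i).factorial_ne_zero
  have hi0 : (∏ i ∈ Finset.Icc 1 n, (i.factorial : ℚ) ^ c i) ≠ 0 :=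
    Finset.prod_ne_zero_iff.mpr fun i _ => pow_ne_zero _ (by exact_mod_cast i.factorial_ne_zero)
  simp only [map_mul, MvPolynomial.eval_C, map_prod, map_pow, MvPolynomial.eval_X, mul_pow,
    Finset.prod_mul_distrib]
  rw [← hmult]
  have hM : (Nat.multinomial (Finset.Icc 1 n) c : ℚ) ≠ 0 := by
    intro h
    rw [h, mul_zero] at hmult
    exact hk hmult.symm
  field_simp

theorem coeff_pow_sum_Icc_of_le (x : ℕ → ℚ) {n N : ℕ} (h : n ≤ N) (k : ℕ) :
    coeff n ((∑ j ∈ Finset.Icc 1 N, C (x j) * X ^ j) ^ k) =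
      coeff n ((∑ j ∈ Finset.Icc 1 n, C (x j) * X ^ j : ℚ⟦X⟧) ^ k) := by
  have hdvd : (X : ℚ⟦X⟧) ^ (n + 1) ∣
      (∑ j ∈ Finset.Icc 1 N, C (x j) * X ^ j) ^ k -
        (∑ j ∈ Finset.Icc 1 n, C (x j) * X ^ j) ^ k := by
    refine dvd_trans ?_ (sub_dvd_pow_sub_pow _ _ k)
    rw [← Finset.sum_sdiff (Finset.Icc_subset_Icc_right h), add_sub_cancel_right]
    refine Finset.dvd_sum fun j hj => Dvd.dvd.mul_left (pow_dvd_pow _ ?_) _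
    simp only [Finset.mem_sdiff, Finset.mem_Icc] at hj
    omega
  have := X_pow_dvd_iff.mp hdvd n (Nat.lt_succ_self n)
  rwa [map_sub, sub_eq_zero] at this

/-- The coefficients of the solution of `V = 1 + ∑ x_j t^j V^(2j)` in terms of partial Bell
polynomials. -/
theorem coeff_eq_sum_partialBell (m : ℕ) (x : ℕ → ℚ) (hx : ∀ j, m < j → x j = 0) (V : ℚ⟦X⟧)
    (hV : V = 1 + ∑ j ∈ Finset.Icc 1 m, C (x j) * X ^ j * V ^ (2 * j)) (n : ℕ) (hn : 1 ≤ n) :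
    coeff n V = ∑ k ∈ Finset.Icc 1 n,
      ((2 * n).choose (k - 1) : ℚ) * (((k - 1).factorial : ℚ) / (n.factorial : ℚ)) *
        MvPolynomial.eval (fun j : ℕ => (j.factorial : ℚ) * x j) (partialBell n k) := by
  -- The equation has indices up to `m` and `partialBell n k` has indices up to `n`; padding to `m +
  -- n` allows truncation to `n` without comparing the two.
  have hg : (∑ j ∈ Finset.Icc 1 m, C (x j) * X ^ j : ℚ⟦X⟧) =
      ∑ j ∈ Finset.Icc 1 (m + n), C (x j) * X ^ j := by
    refine Finset.sum_subset (Finset.Icc_subset_Icc_right (by omega)) fun j hj hj' => ?_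
    simp only [Finset.mem_Icc] at hj hj'
    rw [hx j (by omega), map_zero, zero_mul]
  have h := coeff_pow_of_functional_eq (Finset.Icc 1 m) (fun j hj => (Finset.mem_Icc.mp hj).1)
    x V hV n 1
  rw [hg, pow_one, add_comm (1 : ℚ⟦X⟧), add_pow, map_sum] at h
  simp only [one_pow, mul_one, Nat.cast_one, one_mul] at h
  set g : ℚ⟦X⟧ := ∑ j ∈ Finset.Icc 1 n, C (x j) * X ^ j with hgdef
  have hterm : ∀ k, coeff n ((∑ j ∈ Finset.Icc 1 (m + n), C (x j) * X ^ j : ℚ⟦X⟧) ^ k *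
      ((2 * n + 1).choose k : ℚ⟦X⟧)) = coeff n (g ^ k) * (2 * n + 1).choose k := by
    intro k
    rw [← coeff_pow_sum_Icc_of_le x (Nat.le_add_left n m) k, ← map_natCast (C (R := ℚ)),
      coeff_mul_C]
  have hXg : X ∣ g := Finset.dvd_sum fun j hj => Dvd.dvd.mul_left
    (dvd_pow_self _ (by have := (Finset.mem_Icc.mp hj).1; omega)) _
  rw [Finset.sum_congr rfl fun k _ => hterm k] at h
  have hsub : ∑ k ∈ Finset.range (2 * n + 1 + 1), coeff n (g ^ k) * ((2 * n + 1).choose k : ℚ) =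
      ∑ k ∈ Finset.Icc 1 n, coeff n (g ^ k) * ((2 * n + 1).choose k : ℚ) := by
    symm
    refine Finset.sum_subset ?_ fun k hk hk' => ?_
    · intro k hk
      rw [Finset.mem_Icc] at hk
      rw [Finset.mem_range]
      omega
    · rw [Finset.mem_Icc] at hk'
      rcases Nat.eq_zero_or_pos k with rfl | hk0
      · rw [pow_zero, coeff_one, if_neg (by omega), zero_mul]
      · rw [X_pow_dvd_iff.mp (pow_dvd_pow_of_dvd hXg k) n (by omega), zero_mul]
  rw [hsub] at h
  have h0 : (2 * n + 1 : ℚ) ≠ 0 := by positivity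
  apply mul_left_cancel₀ h0
  rw [h, Finset.mul_sum]
  refine Finset.sum_congr rfl fun k hk => ?_
  obtain ⟨k, rfl⟩ : ∃ l, k = l + 1 := ⟨k - 1, by have := (Finset.mem_Icc.mp hk).1; omega⟩
  rw [eval_partialBell, Nat.add_sub_cancel]
  -- The absorption identity turns `C(2n+1, k+1)/(2n+1)` into `C(2n, k)/(k+1)`.
  have hch : (2 * n + 1 : ℚ) * (2 * n).choose k = (2 * n + 1).choose (k + 1) * (k + 1) := by
    exact_mod_cast Nat.add_one_mul_choose_eq (2 * n) k
  have hnf : (n.factorial : ℚ) ≠ 0 := by exact_mod_cast n.factorial_ne_zero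
  have hkf : (k.factorial : ℚ) ≠ 0 := by exact_mod_cast k.factorial_ne_zero
  have hk1 : (k + 1 : ℚ) ≠ 0 := by positivity
  rw [Nat.factorial_succ]
  push_cast
  field_simp
  linear_combination -coeff n (g ^ (k + 1)) * hch

/-- The equation `V = 1 + ∑ x_j t^j V^(2j)` has at most one solution. -/
theorem functional_eq_unique (s : Finset ℕ) (hs : ∀ j ∈ s, 1 ≤ j) (x : ℕ → ℚ) (V W : ℚ⟦X⟧)
    (hV : V = 1 + ∑ j ∈ s, C (x j) * X ^ j * V ^ (2 * j))
    (hW : W = 1 + ∑ j ∈ s, C (x j) * X ^ j * W ^ (2 * j)) : V = W := by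
  -- Each term contributes `X` from `X ^ j`, as `j ≥ 1`, and `V - W` from the difference of powers.
  have hdvd : X * (V - W) ∣ V - W := by
    have : V - W = ∑ j ∈ s, C (x j) * (X ^ j * (V ^ (2 * j) - W ^ (2 * j))) := by
      nth_rewrite 1 [hV]
      nth_rewrite 1 [hW]
      rw [add_sub_add_left_eq_sub, ← Finset.sum_sub_distrib]
      exact Finset.sum_congr rfl fun j _ => by ring
    nth_rewrite 2 [this]
    refine Finset.dvd_sum fun j hj => Dvd.dvd.mul_left (mul_dvd_mul ?_ ?_) _
    · exact dvd_pow_self _ (by have := hs j hj; omega)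
    · exact sub_dvd_pow_sub_pow _ _ _
  obtain ⟨q, hq⟩ := hdvd
  have h1 : (V - W) * (1 - X * q) = 0 := by linear_combination hq
  rcases mul_eq_zero.mp h1 with h | h
  · exact sub_eq_zero.mp h
  · have := congrArg constantCoeff h
    simp at this

/-! ### Generating functions by length -/

/-- The set of words of a language. -/
abbrev wordSet (L : Language Letter) : Set (List Letter) := {w | w ∈ L}

/-- The generating function of a set of words by length. -/
noncomputable def lengthGF (L : Set (List Letter)) : ℚ⟦X⟧ :=
  PowerSeries.mk fun n => ({w | w ∈ L ∧ w.length = n}.ncard : ℚ)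

theorem finite_sep_length (L : Set (List Letter)) (n : ℕ) :
    {w | w ∈ L ∧ w.length = n}.Finite :=
  (List.finite_length_eq Letter n).subset fun _ hw => hw.2

theorem lengthGF_union {L M : Set (List Letter)} (h : Disjoint L M) :
    lengthGF (L ∪ M) = lengthGF L + lengthGF M := by
  ext n
  rw [map_add, lengthGF, lengthGF, lengthGF, coeff_mk, coeff_mk, coeff_mk]
  have : {w | w ∈ L ∪ M ∧ w.length = n} =
      {w | w ∈ L ∧ w.length = n} ∪ {w | w ∈ M ∧ w.length = n} := by
    ext w
    simp only [Set.mem_union, Set.mem_ofPred_eq]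
    tauto
  rw [this, Set.ncard_union_eq _ (finite_sep_length L n) (finite_sep_length M n)]
  · push_cast
    ring
  · exact h.mono (fun _ hw => hw.1) fun _ hw => hw.1

theorem lengthGF_empty : lengthGF ∅ = 0 := by
  ext n
  simp [lengthGF]

theorem lengthGF_nil : lengthGF {[]} = 1 := by
  ext n
  rw [lengthGF, coeff_mk, coeff_one]
  split_ifs with h
  · subst h
    have : {w : List Letter | w ∈ ({[]} : Set (List Letter)) ∧ w.length = 0} = {[]} := by
      ext w
      simp
    rw [this, Set.ncard_singleton]
    simp
  · have : {w : List Letter | w ∈ ({[]} : Set (List Letter)) ∧ w.length = n} = ∅ := by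
      ext w
      simp only [Set.mem_singleton_iff, Set.mem_ofPred_eq, Set.mem_empty_iff_false, iff_false]
      rintro ⟨rfl, h'⟩
      exact h (by simpa using h'.symm)
    rw [this, Set.ncard_empty]
    simp

theorem coeff_lengthGF_mul (L M : Set (List Letter)) (n : ℕ) :
    coeff n (lengthGF L * lengthGF M) =
      ({p : List Letter × List Letter | p ∈ L ×ˢ M ∧
        p.1.length + p.2.length = n}.ncard : ℚ) := by
  classical
  set P : Set (List Letter × List Letter) :=
    {p | p ∈ L ×ˢ M ∧ p.1.length + p.2.length = n}
  have hsub : ∀ i j, {p | p ∈ L ×ˢ M ∧ p.1.length = i ∧ p.2.length = j} =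
      {w | w ∈ L ∧ w.length = i} ×ˢ {w | w ∈ M ∧ w.length = j} := by
    intro i j
    ext p
    simp only [Set.mem_prod, Set.mem_ofPred_eq]
    tauto
  have hfin : P.Finite := by
    refine Set.Finite.subset ((List.finite_length_le Letter n).prod
      (List.finite_length_le Letter n)) ?_
    rintro p ⟨_, hp⟩
    simp only [Set.mem_prod, Set.mem_ofPred_eq]
    omega
  have hfib := Finset.card_eq_sum_card_fiberwise (s := hfin.toFinset)
    (t := Finset.HasAntidiagonal.antidiagonal n) (f := fun p => (p.1.length, p.2.length))
    (by
      intro p hp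
      simp only [Finset.mem_coe, Set.Finite.mem_toFinset] at hp
      simpa using hp.2)
  rw [Set.ncard_eq_toFinset_card P hfin, hfib, coeff_mul]
  push_cast
  refine Finset.sum_congr rfl fun ij hij => ?_
  rw [lengthGF, lengthGF, coeff_mk, coeff_mk, ← Nat.cast_mul, ← Set.ncard_prod, ← hsub,
    ← Set.ncard_coe_finset]
  congr 2
  ext p
  rw [Finset.HasAntidiagonal.mem_antidiagonal] at hij
  simp only [Set.mem_ofPred_eq, Finset.coe_filter, Set.Finite.mem_toFinset, P, Prod.ext_iff]
  constructor
  · rintro ⟨h1, h2, h3⟩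
    exact ⟨⟨h1, by omega⟩, h2, h3⟩
  · rintro ⟨⟨h1, _⟩, h2, h3⟩
    exact ⟨h1, h2, h3⟩

/-- Injectivity of `f` expresses that the grammar rule is unambiguous; `d` counts the letters it
adds. -/
theorem lengthGF_image (L M : Set (List Letter)) (d : ℕ)
    (f : List Letter × List Letter → List Letter) (hf : Set.InjOn f (L ×ˢ M))
    (hlen : ∀ p, (f p).length = p.1.length + p.2.length + d) :
    lengthGF (f '' (L ×ˢ M)) = X ^ d * (lengthGF L * lengthGF M) := by
  ext n
  rw [coeff_X_pow_mul', coeff_lengthGF_mul, lengthGF, coeff_mk]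
  have himg : {w | w ∈ f '' (L ×ˢ M) ∧ w.length = n} =
      f '' {p | p ∈ L ×ˢ M ∧ p.1.length + p.2.length + d = n} := by
    ext w
    constructor
    · rintro ⟨⟨p, hp, rfl⟩, hn⟩
      exact ⟨p, ⟨hp, by rw [← hlen, hn]⟩, rfl⟩
    · rintro ⟨p, ⟨hp, hn⟩, rfl⟩
      exact ⟨⟨p, hp, rfl⟩, by rw [hlen, hn]⟩
  rw [himg, (hf.mono fun p hp => hp.1).ncard_image]
  split_ifs with h
  · congr 2
    ext p
    simp only [Set.mem_ofPred_eq]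
    exact and_congr_right fun _ => by omega
  · have : {p : List Letter × List Letter | p ∈ L ×ˢ M ∧
        p.1.length + p.2.length + d = n} = ∅ := by
      ext p
      simp only [Set.mem_ofPred_eq, Set.mem_empty_iff_false, iff_false]
      omega
    rw [this, Set.ncard_empty, Nat.cast_zero]

theorem lengthGF_image_of_injective (M : Set (List Letter)) (d : ℕ)
    (f : List Letter → List Letter) (hf : Function.Injective f)
    (hlen : ∀ w, (f w).length = w.length + d) : lengthGF (f '' M) = X ^ d * lengthGF M := by
  have h := lengthGF_image {[]} M d (fun p => f (p.1 ++ p.2)) ?_ fun p => by simp [hlen]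
  · rw [lengthGF_nil, one_mul] at h
    rw [← h]
    congr 1
    ext w
    simp
  · rintro ⟨u, v⟩ ⟨hu, _⟩ ⟨u', v'⟩ ⟨hu', _⟩ e
    simp only [Set.mem_singleton_iff] at hu hu'
    subst hu hu'
    simpa using hf e

/-! ### The grammar as equations between power series -/

theorem lengthGF_langL (m : ℕ) :
    lengthGF (wordSet (langL m 1)) = X * lengthGF (descents m (2 * m)) := by
  have : wordSet (langL m 1) = List.cons Letter.a '' descents m (2 * m) := by
    ext w
    refine (mem_langL_one_iff_descents m w).trans ?_
    constructor <;> rintro ⟨v, hv, rfl⟩ <;> exact ⟨v, hv, rfl⟩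
  rw [this, lengthGF_image_of_injective _ 1 _ List.cons_injective fun w => by simp, pow_one]

theorem lengthGF_descents (m : ℕ) (k : ℤ) (hk : 1 ≤ k) :
    lengthGF (descents m k) = X * lengthGF (descents m (k - 2)) +
      X * lengthGF (wordSet (langL m 1)) * lengthGF (descents m (k - 1)) := by
  set f : List Letter × List Letter → List Letter := fun p => p.1 ++ Letter.b :: p.2
  have hval : ∀ u ∈ langL m 1, val m u < 2 := fun u hu => by
    have : val m u = 1 := by simpa using hu.2.1
    omega
  have hset : descents m k = List.cons Letter.b '' descents m (k - 2) ∪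
      f '' (wordSet (langL m 1) ×ˢ descents m (k - 1)) := by
    ext v
    rw [mem_descents_iff m k hk v, Set.mem_union]
    refine or_congr ?_ ?_
    · simp only [Set.mem_image, eq_comm]
    · constructor
      · rintro ⟨u, hu, v', hv', rfl⟩
        exact ⟨(u, v'), ⟨hu, hv'⟩, rfl⟩
      · rintro ⟨⟨u, v'⟩, ⟨hu, hv'⟩, rfl⟩
        exact ⟨u, hu, v', hv', rfl⟩
  rw [hset, lengthGF_union, lengthGF_image_of_injective _ 1 _ List.cons_injective fun w => by simp,
    lengthGF_image _ _ 1 f, pow_one, mul_assoc]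
  · rintro ⟨u, v⟩ ⟨hu, _⟩ ⟨u', v'⟩ ⟨hu', _⟩ e
    obtain ⟨h1, h2⟩ := first_passage_unique (fun p => val_nonneg_of_prefix_langL hu) (hval u hu)
      (fun p => val_nonneg_of_prefix_langL hu') (hval u' hu') e
    exact Prod.ext h1 h2
  · intro p
    simp only [f, List.length_append, List.length_cons]
    omega
  · rw [Set.disjoint_left]
    rintro _ ⟨v, _, rfl⟩ ⟨⟨u, v'⟩, ⟨hu, _⟩, e⟩
    obtain ⟨h1, _⟩ := first_passage_unique (u' := []) (fun p => val_nonneg_of_prefix_langL hu)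
      (hval u hu) (fun p hp => by rw [List.prefix_nil.mp hp, val_nil]) (by simp) e
    subst h1
    exact nil_notMem_langL m hu

/-- The solution of a second-order linear recurrence with Fibonacci initial values. -/
theorem fib_recurrence_eq_sum {R : Type*} [CommRing R] (T E : R) (s : ℕ → R) (h0 : s 0 = 1)
    (h1 : s 1 = E) (hs : ∀ k, s (k + 2) = T * s k + E * s (k + 1)) (k : ℕ) :
    s k = ∑ p ∈ Finset.HasAntidiagonal.antidiagonal k, (p.1.choose p.2 : R) * T ^ p.2 * E ^ (p.1 - p.2) := by
  induction k using Nat.twoStepInduction with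
  | zero => simp [h0]
  | one => simp [h1, Finset.Nat.antidiagonal_succ]
  | more k ih0 ih1 =>
    rw [hs, ih0, ih1, Finset.Nat.antidiagonal_succ_succ', Finset.Nat.antidiagonal_succ']
    simp only [Finset.sum_cons, Finset.sum_map, Function.Embedding.coe_prodMap, Prod.map,
      Function.Embedding.coeFn_mk, Function.Embedding.refl_apply, Nat.succ_eq_add_one,
      Nat.choose_zero_right, Nat.choose_zero_succ, Nat.cast_one, Nat.cast_zero, pow_zero,
      zero_mul, one_mul, Nat.sub_zero, zero_add, mul_add, Finset.mul_sum]
    rw [add_left_comm, ← Finset.sum_add_distrib, pow_succ' E (k + 1)]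
    congr 1
    refine Finset.sum_congr rfl fun p _ => ?_
    obtain ⟨i, j⟩ := p
    simp only [Nat.choose_succ_succ, Nat.cast_add, Nat.add_sub_add_right]
    -- Pascal's rule gives the identity. The truncated exponent `i - (j+1)` is wrong only for `i ≤
    -- j`, where `C(i, j+1) = 0`.
    rcases lt_or_ge j i with h | h
    · obtain ⟨d, rfl⟩ : ∃ d, i = j + 1 + d := ⟨i - (j + 1), by omega⟩
      rw [show j + 1 + d - j = d + 1 by omega, show j + 1 + d - (j + 1) = d by omega]
      ring
    · rw [Nat.choose_eq_zero_of_lt (by omega : i < j + 1)]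
      push_cast
      ring

theorem lengthGF_descents_two_mul (m : ℕ) :
    lengthGF (descents m (2 * m)) = ∑ j ∈ Finset.range (m + 1),
      (mu m j : ℚ⟦X⟧) * X ^ (m - j) * (X * lengthGF (wordSet (langL m 1))) ^ (2 * j) := by
  have h0 : lengthGF (descents m 0) = 1 := by rw [descents_zero, lengthGF_nil]
  have h := fib_recurrence_eq_sum X (X * lengthGF (wordSet (langL m 1)))
    (fun k : ℕ => lengthGF (descents m k)) (by simpa using h0)
    (by
      have := lengthGF_descents m 1 le_rfl
      norm_num [descents_neg_one, lengthGF_empty, h0] at this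
      simpa using this)
    (fun k => by
      have := lengthGF_descents m ((k + 2 : ℕ) : ℤ) (by push_cast; omega)
      rw [show ((k + 2 : ℕ) : ℤ) - 2 = (k : ℤ) by push_cast; ring,
        show ((k + 2 : ℕ) : ℤ) - 1 = ((k + 1 : ℕ) : ℤ) by push_cast; ring] at this
      exact this) (2 * m)
  push_cast at h
  -- The terms `C(i, 2m-i)` vanish for `i < m`; the substitution `i = m + j` turns the others into
  -- `μ_j`.
  rw [h, Finset.Nat.sum_antidiagonal_eq_sum_range_succ_mk, show (2 * m).succ = m + (m + 1) by omega,
    Finset.sum_range_add, Finset.sum_eq_zero, zero_add]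
  · refine Finset.sum_congr rfl fun j hj => ?_
    have hj' : j ≤ m := Nat.lt_succ_iff.mp (Finset.mem_range.mp hj)
    simp only [mu, if_pos hj']
    rw [show 2 * m - (m + j) = m - j by omega, show m + j - (m - j) = 2 * j by omega]
  · intro i hi
    rw [Finset.mem_range] at hi
    rw [Nat.choose_eq_zero_of_lt (by omega : i < 2 * m - i)]
    simp

theorem val_eq_zero_of_mem_auxLang {m : ℕ} {w : List Letter} (hw : w ∈ auxLang m) :
    val m w = 0 := by
  rcases hw with rfl | h
  · simp
  · exact h.2.1

theorem dvd_length_of_val_eq_zero {m : ℕ} {w : List Letter} (hw : val m w = 0) :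
    2 * m + 3 ∣ w.length := by
  rw [val_eq_count] at hw
  rw [length_eq_count]
  have h : (2 * m + 1) * w.count Letter.a = 2 * w.count Letter.b := by
    zify
    linarith
  obtain ⟨c, hc⟩ : 2 ∣ w.count Letter.a :=
    (Nat.Coprime.dvd_of_dvd_mul_left (k := 2) (by simp) ⟨_, h⟩)
  rw [hc] at h ⊢
  have : w.count Letter.b = (2 * m + 1) * c := by
    apply Nat.eq_of_mul_eq_mul_left two_pos
    rw [← h]
    ring
  exact ⟨c, by rw [this]; ring⟩

/-- Words of valuation 0 have length divisible by `2m + 3`, so counting by length amounts to the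
substitution `t = X^(2m+3)`. -/
theorem lengthGF_auxLang (m : ℕ) :
    lengthGF (wordSet (auxLang m)) = expand (2 * m + 3) (by omega)
      (PowerSeries.mk fun n => (auxCount m n : ℚ)) := by
  ext n
  rw [coeff_expand, lengthGF, coeff_mk]
  split_ifs with h
  · obtain ⟨c, rfl⟩ := h
    rw [Nat.mul_div_cancel_left _ (by omega), coeff_mk, auxCount, auxWords]
    rfl
  · have : {w | w ∈ wordSet (auxLang m) ∧ w.length = n} = ∅ := by
      ext w
      simp only [Set.mem_ofPred_eq, Set.mem_empty_iff_false, iff_false]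
      rintro ⟨hw, rfl⟩
      exact h (dvd_length_of_val_eq_zero (val_eq_zero_of_mem_auxLang hw))
    rw [this, Set.ncard_empty, Nat.cast_zero]

theorem wrap_injective (m : ℕ) : Function.Injective (wrap m) := by
  intro v w h
  simpa [wrap] using h

theorem lengthGF_langL_eq_auxLang (m : ℕ) (hm : 1 ≤ m) :
    lengthGF (wordSet (langL m 1)) = X ^ (m + 1) * lengthGF (wordSet (auxLang m)) := by
  rw [← lengthGF_image_of_injective _ (m + 1) _ (wrap_injective m) fun w => by
    simp [wrap]; omega]
  congr 1
  ext w
  refine (mem_langL_one_iff m hm w).trans ?_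
  constructor <;> rintro ⟨v, hv, rfl⟩ <;> exact ⟨v, hv, rfl⟩

/-- The generating function of `U` satisfies the functional equation. -/
theorem auxCount_functional_eq (m : ℕ) (hm : 1 ≤ m) (V : ℚ⟦X⟧)
    (hV : V = PowerSeries.mk fun n : ℕ => (auxCount m n : ℚ)) :
    V = 1 + ∑ j ∈ Finset.Icc 1 m, C (mu m j : ℚ) * X ^ j * V ^ (2 * j) := by
  have hs : 2 * m + 3 ≠ 0 := by omega
  set A := lengthGF (wordSet (auxLang m)) with hA
  have hexp : A = expand (2 * m + 3) hs V := by rw [hA, lengthGF_auxLang, hV]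
  -- With `L_1 = a U b^m` substituted on both sides, the exponent of `X` in term `j` is `1 + (m-j) +
  -- 2j(m+2) = (m+1) + (2m+3)j`.
  have h1 : X ^ (m + 1) * A = X ^ (m + 1) * ∑ j ∈ Finset.range (m + 1),
      (mu m j : ℚ⟦X⟧) * (X ^ (2 * m + 3)) ^ j * A ^ (2 * j) := by
    have h := lengthGF_langL m
    rw [lengthGF_descents_two_mul, lengthGF_langL_eq_auxLang m hm] at h
    rw [h, Finset.mul_sum, Finset.mul_sum]
    refine Finset.sum_congr rfl fun j hj => ?_
    obtain ⟨i, rfl⟩ : ∃ i, m = j + i := ⟨m - j, by have := Finset.mem_range.mp hj; omega⟩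
    rw [Nat.add_sub_cancel_left]
    ring
  have h2 := mul_left_cancel₀ (pow_ne_zero _ X_ne_zero) h1
  have hinj : Function.Injective (expand (R := ℚ) (2 * m + 3) hs) := by
    intro F G h
    ext n
    have := congrArg (coeff ((2 * m + 3) * n)) h
    rwa [coeff_expand_mul, coeff_expand_mul] at this
  apply hinj
  rw [← hexp, h2, Finset.sum_range_succ', add_comm, map_add, map_one, map_sum]
  congr 1
  · simp [mu]
  · rw [Finset.range_eq_Ico, Finset.sum_Ico_add' (fun j =>
      (mu m j : ℚ⟦X⟧) * (X ^ (2 * m + 3)) ^ j * A ^ (2 * j)) 0 m 1]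
    refine Finset.sum_congr (by ext j; simp) fun j _ => ?_
    rw [map_mul, map_mul, map_pow, map_pow, expand_C, expand_X, ← hexp]
    simp

end FactorFree

theorem theorem3p2 (m : ℕ) (hm : 1 ≤ m) :
    (∀ n : ℕ, 1 ≤ n →
      (FactorFree.auxCount m n : ℚ) =
        ∑ k ∈ Finset.Icc 1 n,
          ((2 * n).choose (k - 1) : ℚ) * (((k - 1).factorial : ℚ) / (n.factorial : ℚ)) *
            MvPolynomial.eval (fun j : ℕ => (j.factorial : ℚ) * (FactorFree.mu m j : ℚ))
              (FactorFree.partialBell n k)) ∧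
    (∀ V : PowerSeries ℚ,
      V = 1 + ∑ j ∈ Finset.Icc 1 m,
          PowerSeries.C (FactorFree.mu m j : ℚ) * PowerSeries.X ^ j * V ^ (2 * j) ↔
        V = PowerSeries.mk (fun n : ℕ => (FactorFree.auxCount m n : ℚ))) := by
  have hU := FactorFree.auxCount_functional_eq m hm _ rfl
  refine ⟨fun n hn => ?_, fun V => ⟨fun hV => ?_, FactorFree.auxCount_functional_eq m hm V⟩⟩
  · have := FactorFree.coeff_eq_sum_partialBell m (fun j => (FactorFree.mu m j : ℚ))
      (fun j hj => by simp [FactorFree.mu, not_le.mpr hj]) _ hU n hn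
    rwa [PowerSeries.coeff_mk] at this
  · exact FactorFree.functional_eq_unique (Finset.Icc 1 m)
      (fun j hj => (Finset.mem_Icc.mp hj).1) (fun j => (FactorFree.mu m j : ℚ)) V _ hV hU
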